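/- Let $M$ and $M'$ be matroids on finite ground sets $F$ and $F'$, with rank functions $r_M$ and $r_{M'}$. Let $\phi\colon F\to F'$ be a map that is a morphism of matroids $M\to M'$, that is, $$r_{M'}(\phi(T_2))-r_{M'}(\phi(T_1))\le r_M(T_2)-r_M(T_1)\qquad\text{for all } T_1\subseteq T_2\subseteq F.$$ A subset $T\subseteq F$ is called a basis of $\phi$ if $T$ is contained in a basis of $M$ and $\phi(T)$ contains a basis of $M'$. Denote by $B_k(\phi)$ the number of bases of $\phi$ of cardinality $k$. Then the sequence $B_k(\phi)$ is log-concave, i.e. $$B_k(\phi)^2\ \ge\ B_{k+1}(\phi)\cdot B_{k-1}(\phi)\qquad\text{for all } k\ge 1.$$ -/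

import Mathlib

namespace Matroid

/-- A map `φ` from the ground set of `M` to the ground set of `M'` is a morphism of (finite)
matroids `M → M'` if `r_{M'}(φ(T₂)) - r_{M'}(φ(T₁)) ≤ r_M(T₂) - r_M(T₁)` for all
`T₁ ⊆ T₂ ⊆ M.E`. The inequality is written additively; all ranks in it are finite
as soon as the two matroids are finite. -/
structure IsMorphism {α β : Type*} (M : Matroid α) (M' : Matroid β) (φ : α → β) : Prop where
  mapsTo : Set.MapsTo φ M.E M'.E
  eRk_le : ∀ ⦃T₁ T₂ : Set α⦄, T₁ ⊆ T₂ → T₂ ⊆ M.E →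
    M'.eRk (φ '' T₂) + M.eRk T₁ ≤ M.eRk T₂ + M'.eRk (φ '' T₁)

/-- `T` is a basis of the morphism `φ : M → M'` if `T` is contained in a basis of `M` and
`φ(T)` contains a basis of `M'`. -/
def IsMorphismBasis {α β : Type*} (M : Matroid α) (M' : Matroid β) (φ : α → β)
    (T : Set α) : Prop :=
  (∃ B, M.IsBase B ∧ T ⊆ B) ∧ ∃ B', M'.IsBase B' ∧ B' ⊆ φ '' T

/-- `B_k(φ)`: the number of bases of the morphism `φ : M → M'` of cardinality `k`. -/
noncomputable def numMorphismBases {α β : Type*} (M : Matroid α) (M' : Matroid β) (φ : α → β)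
    (k : ℕ) : ℕ :=
  {T : Set α | IsMorphismBasis M M' φ T ∧ T.ncard = k}.ncard

end Matroid

open Finset

/-! The inequality is an Alexandrov–Fenchel inequality for a discrete polymatroid. Adjoin to the
ground set of `M` one element `none` that may repeat, and call a multiset of `a` copies of `none`
and an independent set `S` feasible if `a + |S| ≤ c + rk S`, where `rk S` is the rank of `φ(S)` in
`M'`. The morphism inequality makes these multisets polymatroidal
(`IsMatroidQuotient.isPolymatroidal`). Feasible words of length `c + r` with `l` letters other than
`none` in prescribed positions number `l!` times the independent `l`-sets with `r ≤ rk S`. For `r`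
the rank of `M'` this is `l! * B_l`.

For every discrete polymatroid, `wordSum` with nonnegative fixed arguments satisfies a reverse
Cauchy–Schwarz inequality in its two remaining arguments (`IsPolymatroidal.wordSum_hyperbolic`). The
proof is by induction on the number of fixed arguments. With none, the form is a square minus a
positive semidefinite form, because non-extendable pairs form a partial equivalence relation. In
general the inequality after each first letter gives a spectral gap, and Perron–Frobenius on a
connected support leaves at most one positive eigenvalue (`sum_sum_nonpos_of_local`). Taking the
indicators of `none` and of its complement as arguments makes `l! * B_l` log-concave, which is
stronger than the claim. -/

/-- Reverse Cauchy–Schwarz from negative semidefiniteness on a hyperplane, in scalar form. -/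
theorem mul_le_sq_of_hyperplane {a b m l k : ℝ} (hb : 0 ≤ b) (hl : l = 0 → b ≤ 0)
    (h : l ^ 2 * a - 2 * k * l * m + k ^ 2 * b ≤ 0) : a * b ≤ m ^ 2 := by
  rcases hb.eq_or_lt with rfl | hb
  · simpa using sq_nonneg m
  have hl0 : l ≠ 0 := fun h0 => absurd (hl h0) (not_le.2 hb)
  have hl2 : 0 < l ^ 2 := by positivity
  -- Completing the square: `b` times the left side of `h` equals `(k * b - l * m) ^ 2 + l ^ 2 * (a
  -- * b - m ^ 2)`.
  have h1 : l ^ 2 * (a * b - m ^ 2) ≤ 0 := by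
    nlinarith [sq_nonneg (k * b - l * m), mul_le_mul_of_nonneg_right h hb.le]
  nlinarith [nonpos_of_mul_nonpos_right h1 hl2]

/-! ### Quadratic forms: partial equivalence relations and the local-to-global step. -/

section LinearAlgebra

variable {ι : Type*} [Fintype ι]

/-- The indicator of a symmetric and transitive relation is positive semidefinite. -/
theorem sum_sum_nonneg_of_symm_trans (R : ι → ι → Prop) [DecidableRel R]
    (hs : ∀ i j, R i j → R j i) (ht : ∀ i j k, R i j → R j k → R i k) (z : ι → ℝ) :
    0 ≤ ∑ i, ∑ j, z i * z j * (if R i j then 1 else 0) := by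
  classical
  -- The form is a sum of squares over the classes of `R`. An index with `¬ R i i` is related to
  -- nothing, so `z'` discards it.
  let f : ι → Finset ι := fun i => univ.filter (R i)
  let z' : ι → ℝ := fun i => if R i i then z i else 0
  have key : ∑ i, ∑ j, z i * z j * (if R i j then (1 : ℝ) else 0) =
      ∑ c : Finset ι, (∑ i, if f i = c then z' i else 0) ^ 2 := by
    simp_rw [sq, Finset.sum_mul_sum]
    conv_rhs => rw [Finset.sum_comm]
    refine Finset.sum_congr rfl fun i _ => ?_
    conv_rhs => rw [Finset.sum_comm]
    refine Finset.sum_congr rfl fun j _ => ?_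
    rw [Finset.sum_eq_single (f i) (by intro c _ hc; simp [hc.symm]) (by simp)]
    have hiff : R i j ↔ (R i i ∧ R j j ∧ f j = f i) := by
      constructor
      · intro h
        refine ⟨ht _ _ _ h (hs _ _ h), ht _ _ _ (hs _ _ h) h, ?_⟩
        ext k
        simp only [f, mem_filter, mem_univ, true_and]
        exact ⟨fun h' => ht _ _ _ h h', fun h' => ht _ _ _ (hs _ _ h) h'⟩
      · rintro ⟨_, hj, he⟩
        have : j ∈ f j := by simpa [f] using hj
        rw [he] at this
        simpa [f] using this
    simp only [hiff, z']
    by_cases h1 : R i i <;> by_cases h2 : R j j <;> by_cases h3 : f j = f i <;> simp [h1, h2, h3]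
  rw [key]
  positivity

/-- If `Q` is symmetric, nonnegative and connected on its support, `w > 0`, and the operator
`diag (w / Q w) * Q` dominates its own quadratic form, then `Q` is negative semidefinite on the
orthogonal complement of `Q w`. -/
theorem sum_sum_nonpos_of_local [DecidableEq ι] (Q : ι → ι → ℝ) (w p : ι → ℝ)
    (hsymm : ∀ i j, Q i j = Q j i) (hQ : ∀ i j, 0 ≤ Q i j) (hw : ∀ i, 0 < w i)
    (hp : ∀ i, ∑ j, Q i j * w j = p i)
    (hloc : ∀ x : ι → ℝ, ∑ i, ∑ j, x i * Q i j * x j ≤ ∑ i, w i * (∑ j, Q i j * x j) ^ 2 / p i)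
    (hconn : ∀ i j, 0 < p i → 0 < p j → 0 < Q i j ∨ ∃ k, 0 < Q i k ∧ 0 < Q k j)
    (x : ι → ℝ) (hx : ∑ i, x i * p i = 0) :
    ∑ i, ∑ j, x i * Q i j * x j ≤ 0 := by
  have hp0 : ∀ i, 0 ≤ p i := fun i => by
    rw [← hp]; exact Finset.sum_nonneg fun j _ => mul_nonneg (hQ i j) (hw j).le
  have hQ0 : ∀ i, p i = 0 → ∀ j, Q i j = 0 := by
    intro i hi j
    rw [← hp, Finset.sum_eq_zero_iff_of_nonneg
      (fun j _ => mul_nonneg (hQ i j) (hw j).le)] at hi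
    exact (mul_eq_zero.1 (hi j (mem_univ j))).resolve_right (hw j).ne'
  -- Conjugation by `g` turns `diag (w / p) * Q` into the symmetric matrix `S = g Q g`, with `S v =
  -- v`. Where `p i = 0`, division by zero gives `g i = 0`, consistent with the vanishing of row `i`
  -- of `Q`.
  let g : ι → ℝ := fun i => √(w i / p i)
  let v : ι → ℝ := fun i => √(w i * p i)
  have hgg : ∀ i, g i ^ 2 = w i / p i := fun i => Real.sq_sqrt (div_nonneg (hw i).le (hp0 i))
  have hg0 : ∀ i, p i = 0 → g i = 0 := fun i hi => by simp [g, hi]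
  have hgpos : ∀ i, 0 < p i → 0 < g i := fun i hi => Real.sqrt_pos.2 (div_pos (hw i) hi)
  have hgv : ∀ i, 0 < p i → g i * v i = w i := by
    intro i hi
    simp only [g, v]
    rw [← Real.sqrt_mul (div_nonneg (hw i).le hi.le), show w i / p i * (w i * p i) = w i ^ 2 by
      field_simp, Real.sqrt_sq (hw i).le]
  have hgp : ∀ i, g i * p i = v i := by
    intro i
    rcases (hp0 i).eq_or_lt with hi | hi
    · simp [g, v, ← hi]
    · have h1 : v i ^ 2 = w i * p i := Real.sq_sqrt (mul_nonneg (hw i).le hi.le)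
      have h2 := hgv i hi
      have h3 := hgpos i hi
      have h4 : v i * (g i * p i - v i) = 0 := by
        rw [mul_sub]; nlinarith
      have h5 : 0 < v i := Real.sqrt_pos.2 (mul_pos (hw i) hi)
      have := (mul_eq_zero.1 h4).resolve_left h5.ne'
      linarith
  have hvv : ∀ i, v i ^ 2 = w i * p i := fun i => Real.sq_sqrt (mul_nonneg (hw i).le (hp0 i))
  set V : ℝ := ∑ i, v i ^ 2 with hV
  rcases (show 0 ≤ V from Finset.sum_nonneg fun i _ => sq_nonneg _).eq_or_lt with hV0 | hVpos
  · have : ∀ i j, Q i j = 0 := by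
      intro i
      refine hQ0 i ?_
      have := (Finset.sum_eq_zero_iff_of_nonneg (fun i _ => sq_nonneg (v i))).1 hV0.symm i
        (mem_univ i)
      rw [hvv] at this
      exact (mul_eq_zero.1 this).resolve_left (hw i).ne'
    simp [this]
  let T : Matrix ι ι ℝ := Matrix.of fun i j => v i * v j / V - g i * Q i j * g j
  have hSv : ∀ i, ∑ j, g i * Q i j * g j * v j = v i := by
    intro i
    rw [← hgp i, ← hp i, Finset.mul_sum]
    refine Finset.sum_congr rfl fun j _ => ?_
    rcases (hp0 j).eq_or_lt with hj | hj
    · rw [hsymm i j, hQ0 j hj.symm]; simp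
    · rw [mul_assoc, hgv j hj, mul_assoc]
  have hT : T.IsHermitian := by
    ext i j
    simp only [T, Matrix.conjTranspose_apply, Matrix.of_apply, star_trivial]
    rw [hsymm j i]; ring
  have hTpos : T.PosSemidef := by
    rw [hT.posSemidef_iff_eigenvalues_nonneg]
    intro n
    by_contra hneg
    simp only [Pi.zero_apply, not_le] at hneg
    set lam : ℝ := - hT.eigenvalues n with hlam
    have hlpos : 0 < lam := by linarith
    let y : ι → ℝ := fun i => hT.eigenvectorBasis n i
    have hy0 : y ≠ 0 := by
      intro h
      apply hT.eigenvectorBasis.toBasis.ne_zero n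
      ext i
      simpa [y] using congrFun h i
    have hTy : ∀ i, ∑ j, (v i * v j / V - g i * Q i j * g j) * y j = - lam * y i := by
      intro i
      have := congrFun (hT.mulVec_eigenvectorBasis n) i
      simpa [T, Matrix.mulVec, dotProduct, y, hlam] using this
    have hTy' : ∀ i, ∑ j, g i * Q i j * g j * y j = lam * y i + v i * (∑ j, v j * y j) / V := by
      intro i
      have h1 := hTy i
      simp only [sub_mul, Finset.sum_sub_distrib] at h1
      have h2 : ∑ j, v i * v j / V * y j = v i * (∑ j, v j * y j) / V := by
        rw [Finset.mul_sum, Finset.sum_div]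
        exact Finset.sum_congr rfl fun j _ => by ring
      linarith
    -- Pairing `S y = lam * y + v (v · y) / V` with the fixed vector `v` leaves `lam * (v · y) = 0`,
    -- so `y` is an eigenvector of `S` for `lam`.
    have hvy : ∑ j, v j * y j = 0 := by
      have h1 : ∑ i, v i * ∑ j, g i * Q i j * g j * y j = ∑ j, v j * y j := by
        simp_rw [Finset.mul_sum]
        rw [Finset.sum_comm]
        refine Finset.sum_congr rfl fun j _ => ?_
        rw [← hSv j, Finset.sum_mul]
        refine Finset.sum_congr rfl fun i _ => ?_
        rw [hsymm i j]; ring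
      simp_rw [hTy'] at h1
      have h2 : ∑ i, v i * (lam * y i + v i * (∑ j, v j * y j) / V) =
          lam * (∑ j, v j * y j) + V * (∑ j, v j * y j) / V := by
        rw [hV, Finset.sum_mul, Finset.sum_div, Finset.mul_sum, ← Finset.sum_add_distrib]
        exact Finset.sum_congr rfl fun j _ => by ring
      rw [h2, mul_div_assoc, mul_div_cancel₀ _ hVpos.ne'] at h1
      have : lam * (∑ j, v j * y j) = 0 := by linarith
      exact (mul_eq_zero.1 this).resolve_left hlpos.ne'
    have hSy : ∀ i, g i * ∑ j, Q i j * (g j * y j) = lam * y i := by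
      intro i
      rw [Finset.mul_sum]
      have := hTy' i
      rw [hvy] at this
      simp only [mul_zero, zero_div, add_zero] at this
      rw [← this]
      exact Finset.sum_congr rfl fun j _ => by ring
    let Y : ℝ := ∑ i, y i ^ 2
    have hYpos : 0 < Y := by
      refine (show 0 ≤ Y from Finset.sum_nonneg fun i _ => sq_nonneg _).lt_of_ne' fun h => hy0 ?_
      funext i
      have := (Finset.sum_eq_zero_iff_of_nonneg (fun i _ => sq_nonneg (y i))).1 h i (mem_univ i)
      simpa using this
    have hquad : ∑ i, ∑ j, (g i * y i) * Q i j * (g j * y j) = lam * Y := by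
      rw [Finset.mul_sum]
      refine Finset.sum_congr rfl fun i _ => ?_
      have := hSy i
      calc ∑ j, (g i * y i) * Q i j * (g j * y j) = y i * (g i * ∑ j, Q i j * (g j * y j)) := by
            simp_rw [Finset.mul_sum]
            exact Finset.sum_congr rfl fun j _ => by ring
        _ = lam * y i ^ 2 := by rw [this]; ring
    -- In the coordinates `x = g y`, `hloc` says `S ≤ S ^ 2`, which excludes eigenvalues in `(0,
    -- 1)`.
    have hlam1 : 1 ≤ lam := by
      have h1 := hloc fun i => g i * y i
      rw [hquad] at h1
      have h2 : ∑ i, w i * (∑ j, Q i j * (g j * y j)) ^ 2 / p i = lam ^ 2 * Y := by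
        rw [Finset.mul_sum]
        refine Finset.sum_congr rfl fun i _ => ?_
        rw [← mul_pow, ← hSy i, mul_pow, hgg]
        ring
      rw [h2] at h1
      have : 0 ≤ (lam * Y) * (lam - 1) := by nlinarith
      have := nonneg_of_mul_nonneg_right this (mul_pos hlpos hYpos)
      linarith
    -- Perron–Frobenius through the Dirichlet form: its value is at most `2 * (1 - lam) * Y ≤ 0`, so
    -- `t` is constant along the connected support. Then `y` is a multiple of `v` and also
    -- orthogonal to `v`.
    let t : ι → ℝ := fun i => g i * y i / w i
    have hdir : ∑ i, ∑ j, Q i j * w i * w j * (t i - t j) ^ 2 =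
        2 * ∑ i, p i * (g i * y i) ^ 2 / w i - 2 * (lam * Y) := by
      have hexp : ∀ i j, Q i j * w i * w j * (t i - t j) ^ 2 =
          (Q i j * w j) * ((g i * y i) ^ 2 / w i) + (Q j i * w i) * ((g j * y j) ^ 2 / w j)
            - 2 * ((g i * y i) * Q i j * (g j * y j)) := by
        intro i j
        have := (hw i).ne'
        have := (hw j).ne'
        rw [hsymm j i]
        simp only [t]
        field_simp
        ring
      have e1 : ∑ i, ∑ j, (Q i j * w j) * ((g i * y i) ^ 2 / w i) =
          ∑ i, p i * (g i * y i) ^ 2 / w i :=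
        Finset.sum_congr rfl fun i _ => by rw [← Finset.sum_mul, hp, mul_div_assoc]
      simp_rw [hexp, Finset.sum_sub_distrib, Finset.sum_add_distrib]
      rw [Finset.sum_comm (f := fun i j => (Q j i * w i) * ((g j * y j) ^ 2 / w j)), e1, ← hquad]
      simp_rw [← Finset.mul_sum]
      ring
    have hle : ∑ i, p i * (g i * y i) ^ 2 / w i ≤ Y := by
      refine Finset.sum_le_sum fun i _ => ?_
      rw [mul_pow, hgg]
      rcases (hp0 i).eq_or_lt with hi | hi
      · simp [← hi]; positivity
      · have := (hw i).ne'
        apply le_of_eq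
        field_simp
    have hnn : ∀ i j, 0 ≤ Q i j * w i * w j * (t i - t j) ^ 2 := fun i j =>
      mul_nonneg (mul_nonneg (mul_nonneg (hQ i j) (hw i).le) (hw j).le) (sq_nonneg _)
    have hzero : ∑ i, ∑ j, Q i j * w i * w j * (t i - t j) ^ 2 = 0 := by
      refine le_antisymm ?_ (Finset.sum_nonneg fun i _ => Finset.sum_nonneg fun j _ => hnn i j)
      rw [hdir]
      nlinarith
    have hteq : ∀ i j, 0 < Q i j → t i = t j := by
      intro i j hij
      have h1 := (Finset.sum_eq_zero_iff_of_nonneg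
        (fun i _ => Finset.sum_nonneg fun j _ => hnn i j)).1 hzero i (mem_univ i)
      have h2 := (Finset.sum_eq_zero_iff_of_nonneg (fun j _ => hnn i j)).1 h1 j (mem_univ j)
      have h3 := (mul_eq_zero.1 h2).resolve_left (mul_pos (mul_pos hij (hw i)) (hw j)).ne'
      exact sub_eq_zero.1 (pow_eq_zero_iff (two_ne_zero)|>.1 h3)
    have hteq' : ∀ i j, 0 < p i → 0 < p j → t i = t j := by
      intro i j hi hj
      rcases hconn i j hi hj with h | ⟨k, h1, h2⟩
      · exact hteq i j h
      · exact (hteq i k h1).trans (hteq k j h2)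
    have hyt : ∀ i, y i = t i * v i := by
      intro i
      rcases (hp0 i).eq_or_lt with hi | hi
      · have := hSy i
        rw [hg0 i hi.symm, zero_mul] at this
        have h0 : y i = 0 := ((mul_eq_zero.1 this.symm).resolve_left hlpos.ne')
        simp [t, h0]
      · simp only [t]
        have h1 := hgv i hi
        rw [← h1]
        have h2 : g i ≠ 0 := (hgpos i hi).ne'
        have h3 : v i ≠ 0 := fun h => by rw [h, mul_zero] at h1; exact (hw i).ne h1
        field_simp
    apply hy0
    funext i
    rcases (hp0 i).eq_or_lt with hi | hi
    · rw [hyt i]; simp [v, ← hi]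
    · have h1 : ∑ j, v j * y j = t i * V := by
        rw [hV, Finset.mul_sum]
        refine Finset.sum_congr rfl fun j _ => ?_
        rcases (hp0 j).eq_or_lt with hj | hj
        · simp [v, ← hj]
        · rw [hyt j, hteq' j i hj hi]; ring
      rw [hvy] at h1
      have h2 : t i = 0 := (mul_eq_zero.1 h1.symm).resolve_right hVpos.ne'
      rw [hyt i, h2]; simp
  let y : ι → ℝ := fun i => x i / g i
  have hfin := hTpos.dotProduct_mulVec_nonneg y
  have hcalc : star y ⬝ᵥ T.mulVec y = (∑ i, v i * y i) ^ 2 / V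
      - ∑ i, ∑ j, x i * Q i j * x j := by
    have hgy : ∀ i, 0 < p i → g i * y i = x i := fun i hi =>
      mul_div_cancel₀ _ (hgpos i hi).ne'
    have hsq : (∑ i, v i * y i) ^ 2 / V = ∑ i, ∑ j, (v i * y i) * (v j * y j) / V := by
      rw [sq, Finset.sum_mul_sum, Finset.sum_div]
      exact Finset.sum_congr rfl fun i _ => Finset.sum_div _ _ _
    rw [hsq]
    simp only [dotProduct, Matrix.mulVec, T, Matrix.of_apply, star_trivial,
      Finset.mul_sum, ← Finset.sum_sub_distrib]
    refine Finset.sum_congr rfl fun i _ => Finset.sum_congr rfl fun j _ => ?_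
    have : (g i * y i) * Q i j * (g j * y j) = x i * Q i j * x j := by
      rcases (hp0 i).eq_or_lt with hi | hi
      · rw [hQ0 i hi.symm]; simp
      rcases (hp0 j).eq_or_lt with hj | hj
      · rw [hsymm i j, hQ0 j hj.symm]; simp
      rw [hgy i hi, hgy j hj]
    rw [← this]
    ring
  have hvy : ∑ i, v i * y i = 0 := by
    rw [← hx]
    refine Finset.sum_congr rfl fun i _ => ?_
    rcases (hp0 i).eq_or_lt with hi | hi
    · simp [v, ← hi]
    · rw [← hgp i]
      simp only [y]
      have := (hgpos i hi).ne'
      field_simp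
  rw [hcalc, hvy] at hfin
  simp only [ne_eq, OfNat.ofNat_ne_zero, not_false_eq_true, zero_pow, zero_div, zero_sub] at hfin
  linarith

end LinearAlgebra

/-! ### Discrete polymatroids and exchange. -/

section Polymatroid

variable {ι : Type*} [DecidableEq ι]

/-- The feasible multisets form a discrete polymatroid. -/
structure IsPolymatroidal (Ok : Multiset ι → Prop) : Prop where
  of_cons : ∀ i s, Ok (i ::ₘ s) → Ok s
  augment : ∀ s t, Ok s → Ok t → Multiset.card s < Multiset.card t →
    ∃ i, s.count i < t.count i ∧ Ok (i ::ₘ s)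

namespace IsPolymatroidal

variable {Ok : Multiset ι → Prop}

theorem of_add (h : IsPolymatroidal Ok) {s : Multiset ι} (t : Multiset ι) (ht : Ok (t + s)) :
    Ok s := by
  induction t using Multiset.induction with
  | empty => simpa using ht
  | cons i t ih => exact ih (h.of_cons i _ (by rwa [Multiset.cons_add] at ht))

theorem exists_extension (h : IsPolymatroidal Ok) (n : ℕ) {s t : Multiset ι} (hs : Ok s)
    (ht : Ok t) (hn : Multiset.card t = n + Multiset.card s) :
    ∃ r : Multiset ι, Multiset.card r = n ∧ Ok (r + s) := by
  induction n generalizing s with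
  | zero => exact ⟨0, rfl, by simpa using hs⟩
  | succ n ih =>
    obtain ⟨i, -, hi⟩ := h.augment s t hs ht (by omega)
    obtain ⟨r, hr, hOk⟩ := ih hi (by rw [hn, Multiset.card_cons]; omega)
    exact ⟨i ::ₘ r, by simp [hr], by rwa [Multiset.cons_add, ← Multiset.add_cons]⟩

/-- This yields both the transitivity of "feasible singly but not jointly" and the paths of length
two in the support of the quadratic form. -/
theorem exchange (h : IsPolymatroidal Ok) {s : Multiset ι} {i j k : ι} (hj : Ok (j ::ₘ s))
    (hik : Ok (k ::ₘ i ::ₘ s)) : Ok (j ::ₘ i ::ₘ s) ∨ Ok (k ::ₘ j ::ₘ s) := by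
  obtain ⟨l, hl, hOk⟩ := h.augment _ _ hj hik (by simp)
  have hl' : l = i ∨ l = k := by
    by_contra! hne
    simp only [Multiset.count_cons, hne.1, hne.2, if_false] at hl
    omega
  rcases hl' with rfl | rfl
  · left; rwa [Multiset.cons_swap]
  · right; exact hOk

end IsPolymatroidal

end Polymatroid

/-! ### Word sums and their Alexandrov–Fenchel inequality. -/

section WordSum

variable {ι : Type*} [Fintype ι]

open Classical in
/-- The sum over all words `i₁ ⋯ iₘ` such that `{i₁, …, iₘ} + s` is feasible of the
products `u₁ i₁ ⋯ uₘ iₘ`. -/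
noncomputable def wordSum (Ok : Multiset ι → Prop) : Multiset ι → List (ι → ℝ) → ℝ
  | s, [] => if Ok s then 1 else 0
  | s, u :: us => ∑ i, u i * wordSum Ok (i ::ₘ s) us

variable {Ok : Multiset ι → Prop}

theorem wordSum_cons (s : Multiset ι) (u : ι → ℝ) (us : List (ι → ℝ)) :
    wordSum Ok s (u :: us) = ∑ i, u i * wordSum Ok (i ::ₘ s) us := rfl

theorem wordSum_perm {us vs : List (ι → ℝ)} (h : us.Perm vs) (s : Multiset ι) :
    wordSum Ok s us = wordSum Ok s vs := by
  induction h generalizing s with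
  | nil => rfl
  | cons u _ ih => simp only [wordSum, ih]
  | swap u v l =>
    simp only [wordSum, Finset.mul_sum]
    rw [Finset.sum_comm]
    refine Finset.sum_congr rfl fun i _ => Finset.sum_congr rfl fun j _ => ?_
    rw [Multiset.cons_swap]; ring
  | trans _ _ ih₁ ih₂ => exact (ih₁ s).trans (ih₂ s)

theorem wordSum_eq_zero {us : List (ι → ℝ)} {s : Multiset ι}
    (h : ∀ t : Multiset ι, Multiset.card t = us.length → ¬ Ok (t + s)) : wordSum Ok s us = 0 := by
  induction us generalizing s with
  | nil => simpa [wordSum] using h 0 rfl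
  | cons u us ih =>
    refine Finset.sum_eq_zero fun i _ => ?_
    rw [ih, mul_zero]
    intro t ht hOk
    refine h (i ::ₘ t) (by simp [ht]) ?_
    rwa [Multiset.cons_add, ← Multiset.add_cons]

theorem wordSum_nonneg {us : List (ι → ℝ)} (hus : ∀ u ∈ us, ∀ i, 0 < u i) (s : Multiset ι) :
    0 ≤ wordSum Ok s us := by
  induction us generalizing s with
  | nil => simp only [wordSum]; split_ifs <;> norm_num
  | cons u us ih =>
    simp only [List.mem_cons, forall_eq_or_imp] at hus
    exact Finset.sum_nonneg fun i _ => mul_nonneg (hus.1 i).le (ih hus.2 _)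

theorem wordSum_pos {us : List (ι → ℝ)} (hus : ∀ u ∈ us, ∀ i, 0 < u i) {s t : Multiset ι}
    (ht : Multiset.card t = us.length) (hOk : Ok (t + s)) : 0 < wordSum Ok s us := by
  induction us generalizing s t with
  | nil =>
    obtain rfl := Multiset.card_eq_zero.1 ht
    rw [zero_add] at hOk
    simp [wordSum, hOk]
  | cons u us ih =>
    simp only [List.mem_cons, forall_eq_or_imp] at hus
    obtain ⟨i, t, rfl⟩ : ∃ i t', t = i ::ₘ t' := by
      obtain ⟨i, hi⟩ := Multiset.card_pos_iff_exists_mem.1 (by rw [ht]; simp)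
      exact ⟨i, _, (Multiset.exists_cons_of_mem hi).choose_spec⟩
    refine Finset.sum_pos' (fun j _ => mul_nonneg (hus.1 j).le (wordSum_nonneg hus.2 _))
      ⟨i, mem_univ i, mul_pos (hus.1 i) (ih hus.2 (t := t) (by simpa using ht) ?_)⟩
    rwa [Multiset.cons_add, ← Multiset.add_cons] at hOk

theorem wordSum_pos_iff {us : List (ι → ℝ)} (hus : ∀ u ∈ us, ∀ i, 0 < u i) {s : Multiset ι} :
    0 < wordSum Ok s us ↔ ∃ t : Multiset ι, Multiset.card t = us.length ∧ Ok (t + s) := by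
  refine ⟨fun h => ?_, fun ⟨t, ht, hOk⟩ => wordSum_pos hus ht hOk⟩
  by_contra! hc
  exact h.ne' (wordSum_eq_zero hc)

theorem wordSum_cons_cons_self (s : Multiset ι) (x y : ι → ℝ) (us : List (ι → ℝ)) :
    wordSum Ok s (x :: y :: us) = ∑ i, ∑ j, x i * wordSum Ok (j ::ₘ i ::ₘ s) us * y j := by
  simp only [wordSum, Finset.mul_sum]
  exact Finset.sum_congr rfl fun i _ => Finset.sum_congr rfl fun j _ => by ring

theorem wordSum_smul_sub (s : Multiset ι) (a b : ℝ) (x y : ι → ℝ) (us : List (ι → ℝ)) :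
    wordSum Ok s ((fun i => a * x i - b * y i) :: us) =
      a * wordSum Ok s (x :: us) - b * wordSum Ok s (y :: us) := by
  simp only [wordSum, Finset.mul_sum, ← Finset.sum_sub_distrib]
  exact Finset.sum_congr rfl fun i _ => by ring

theorem wordSum_swap (s : Multiset ι) (x y : ι → ℝ) (us : List (ι → ℝ)) :
    wordSum Ok s (x :: y :: us) = wordSum Ok s (y :: x :: us) :=
  wordSum_perm (List.Perm.swap _ _ _) s

/-- Hyperbolicity of the quadratic form `(x, y) ↦ wordSum Ok s (x :: y :: us)` follows from its
negativity on the kernel of some linear functional `c`. -/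
theorem wordSum_mul_le_sq_of_hyperplane {s : Multiset ι} {us : List (ι → ℝ)} (c : ι → ℝ)
    (hc : ∀ z : ι → ℝ, ∑ i, z i * c i = 0 → wordSum Ok s (z :: z :: us) ≤ 0)
    (x : ι → ℝ) {y : ι → ℝ} (hy : 0 ≤ wordSum Ok s (y :: y :: us)) :
    wordSum Ok s (x :: x :: us) * wordSum Ok s (y :: y :: us) ≤
      wordSum Ok s (x :: y :: us) ^ 2 := by
  refine mul_le_sq_of_hyperplane (l := ∑ i, y i * c i) (k := ∑ i, x i * c i) hy (hc y) ?_
  have := hc (fun i => (∑ i, y i * c i) * x i - (∑ i, x i * c i) * y i) (by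
    simp only [sub_mul, mul_assoc, Finset.sum_sub_distrib, ← Finset.mul_sum]; ring)
  rw [wordSum_smul_sub, wordSum_swap s x, wordSum_swap s y, wordSum_smul_sub,
    wordSum_smul_sub, wordSum_swap s y x] at this
  linarith

theorem continuous_wordSum_add (us : List (ι → ℝ)) (s : Multiset ι) :
    Continuous fun ε : ℝ => wordSum Ok s (us.map fun u i => u i + ε) := by
  induction us generalizing s with
  | nil => exact continuous_const
  | cons u us ih =>
    simp only [List.map_cons, wordSum]
    exact continuous_finsetSum _ fun i _ => (continuous_const.add continuous_id).mul (ih _)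

variable [DecidableEq ι]

namespace IsPolymatroidal

theorem wordSum_nil_hyperbolic (h : IsPolymatroidal Ok) (s : Multiset ι) (x : ι → ℝ)
    {y : ι → ℝ} (hy : 0 ≤ wordSum Ok s [y, y]) :
    wordSum Ok s [x, x] * wordSum Ok s [y, y] ≤ wordSum Ok s [x, y] ^ 2 := by
  classical
  refine wordSum_mul_le_sq_of_hyperplane (fun i => if Ok (i ::ₘ s) then 1 else 0)
    (fun z hz => ?_) x hy
  -- For a matroid this is parallelism in the contraction by `s`. Here it may fail to be reflexive,
  -- since a letter can be feasible twice.
  let R : ι → ι → Prop := fun i j => Ok (i ::ₘ s) ∧ Ok (j ::ₘ s) ∧ ¬ Ok (j ::ₘ i ::ₘ s)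
  have hR := sum_sum_nonneg_of_symm_trans R
    (fun i j ⟨h1, h2, h3⟩ => ⟨h2, h1, by rwa [Multiset.cons_swap]⟩)
    (fun i j k ⟨h1, h2, h3⟩ ⟨_, h5, h6⟩ => ⟨h1, h5, fun hik =>
      (h.exchange h2 hik).elim h3 h6⟩) z
  have : wordSum Ok s [z, z] = (∑ i, z i * if Ok (i ::ₘ s) then 1 else 0) ^ 2 -
      ∑ i, ∑ j, z i * z j * (if R i j then 1 else 0) := by
    rw [wordSum_cons_cons_self, sq, Finset.sum_mul_sum, ← Finset.sum_sub_distrib]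
    refine Finset.sum_congr rfl fun i _ => ?_
    rw [← Finset.sum_sub_distrib]
    refine Finset.sum_congr rfl fun j _ => ?_
    have hd : Ok (j ::ₘ i ::ₘ s) → Ok (i ::ₘ s) ∧ Ok (j ::ₘ s) := fun h' =>
      ⟨h.of_cons _ _ h', h.of_cons i _ (by rwa [Multiset.cons_swap])⟩
    simp only [wordSum, R]
    by_cases h1 : Ok (i ::ₘ s) <;> by_cases h2 : Ok (j ::ₘ s) <;>
      by_cases h3 : Ok (j ::ₘ i ::ₘ s) <;> simp_all
  rw [this, hz]
  linarith

/-- The Alexandrov–Fenchel inequality for polymatroidal word sums. -/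
theorem wordSum_hyperbolic_of_pos (h : IsPolymatroidal Ok) {us : List (ι → ℝ)}
    (hus : ∀ u ∈ us, ∀ i, 0 < u i) (s : Multiset ι) (x : ι → ℝ) {y : ι → ℝ}
    (hy : ∀ i, 0 < y i) :
    wordSum Ok s (x :: x :: us) * wordSum Ok s (y :: y :: us) ≤
      wordSum Ok s (x :: y :: us) ^ 2 := by
  induction us generalizing s x y with
  | nil =>
    exact h.wordSum_nil_hyperbolic s x (wordSum_nonneg (by simpa using hy) s)
  | cons w us ih =>
    have hus' := hus
    simp only [List.mem_cons, forall_eq_or_imp] at hus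
    obtain ⟨hw, hu⟩ := hus
    have hww : ∀ u ∈ w :: w :: us, ∀ i, 0 < u i := by
      simp only [List.mem_cons, forall_eq_or_imp]; exact ⟨hw, hw, hu⟩
    let Q : ι → ι → ℝ := fun i j => wordSum Ok (j ::ₘ i ::ₘ s) (w :: us)
    let p : ι → ℝ := fun i => wordSum Ok (i ::ₘ s) (w :: w :: us)
    have hQx : ∀ (x : ι → ℝ) (i : ι),
        ∑ j, Q i j * x j = wordSum Ok (i ::ₘ s) (x :: w :: us) := fun x i => by
      rw [wordSum_cons]; exact Finset.sum_congr rfl fun j _ => mul_comm _ _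
    have hpos : ∀ i, 0 < p i → ∃ t : Multiset ι, Multiset.card t = us.length + 2 ∧
        Ok (t + i ::ₘ s) := fun i hi => by
      simpa using (wordSum_pos_iff hww).1 hi
    have hQpos : ∀ i j, Ok (j ::ₘ i ::ₘ s) → (∃ t, Ok t ∧ Multiset.card t =
        us.length + 3 + Multiset.card s) → 0 < Q i j := by
      rintro i j hij ⟨t, ht, hc⟩
      refine (wordSum_pos_iff hus').2 ?_
      refine h.exists_extension _ hij ht ?_
      simp [hc]; try omega
    refine wordSum_mul_le_sq_of_hyperplane p (fun z hz => ?_) x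
      (wordSum_nonneg (by
        simp only [List.mem_cons, forall_eq_or_imp]; exact ⟨hy, hy, hw, hu⟩) s)
    rw [wordSum_cons_cons_self]
    refine sum_sum_nonpos_of_local Q w p (fun i j => ?_) (fun i j => wordSum_nonneg hus' _) hw
      (hQx w) (fun x => ?_) (fun i j hi hj => ?_) z hz
    · simp only [Q]; rw [Multiset.cons_swap]
    · have e : ∑ i, ∑ j, x i * Q i j * x j = ∑ i, w i * wordSum Ok (i ::ₘ s) (x :: x :: us) := by
        rw [← wordSum_cons_cons_self, ← wordSum_cons]
        refine wordSum_perm ?_ s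
        exact ((List.Perm.swap w x us).cons x).trans (List.Perm.swap w x _)
      rw [e]
      refine Finset.sum_le_sum fun i _ => ?_
      rw [hQx, mul_div_assoc]
      refine mul_le_mul_of_nonneg_left ?_ (hw i).le
      rcases (wordSum_nonneg hww (i ::ₘ s)).eq_or_lt with h0 | h0
      · have : wordSum Ok (i ::ₘ s) (x :: x :: us) = 0 := by
          refine wordSum_eq_zero fun t ht hOk => ?_
          exact h0.not_lt (wordSum_pos hww (t := t) (by simpa using ht) hOk)
        rw [this]
        exact div_nonneg (sq_nonneg _) (wordSum_nonneg hww _)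
      · rw [le_div_iff₀ h0]
        exact ih hu (i ::ₘ s) x hw
    · obtain ⟨t, ht, hOk⟩ := hpos i hi
      obtain ⟨t', -, hOk'⟩ := hpos j hj
      have hj' : Ok (j ::ₘ s) := h.of_add t' hOk'
      have hbig : ∃ t, Ok t ∧ Multiset.card t = us.length + 3 + Multiset.card s :=
        ⟨_, hOk, by simp [ht]; omega⟩
      by_cases hij : Ok (j ::ₘ i ::ₘ s)
      · exact Or.inl (hQpos i j hij hbig)
      · right
        obtain ⟨k, hk⟩ := Multiset.card_pos_iff_exists_mem.1 (by rw [ht]; omega : 0 < Multiset.card t)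
        obtain ⟨t, rfl⟩ := Multiset.exists_cons_of_mem hk
        have hik : Ok (k ::ₘ i ::ₘ s) := h.of_add t (by
          rwa [Multiset.cons_add, ← Multiset.add_cons] at hOk)
        have hjk := (h.exchange hj' hik).resolve_left hij
        exact ⟨k, hQpos i k hik hbig, hQpos k j (by rwa [Multiset.cons_swap]) hbig⟩

end IsPolymatroidal

/-- Perturb every argument by `ε > 0` and let `ε` tend to zero. -/
theorem IsPolymatroidal.wordSum_hyperbolic (h : IsPolymatroidal Ok) {us : List (ι → ℝ)}
    (hus : ∀ u ∈ us, ∀ i, 0 ≤ u i) (s : Multiset ι) (x : ι → ℝ) {y : ι → ℝ}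
    (hy : ∀ i, 0 ≤ y i) :
    wordSum Ok s (x :: x :: us) * wordSum Ok s (y :: y :: us) ≤
      wordSum Ok s (x :: y :: us) ^ 2 := by
  have key : ∀ ε : ℝ, 0 < ε →
      wordSum Ok s ((x :: x :: us).map fun u i => u i + ε) *
        wordSum Ok s ((y :: y :: us).map fun u i => u i + ε) ≤
      wordSum Ok s ((x :: y :: us).map fun u i => u i + ε) ^ 2 := by
    intro ε hε
    simp only [List.map_cons]
    refine h.wordSum_hyperbolic_of_pos (us := us.map fun u i => u i + ε) ?_ s
      (fun i => x i + ε) (y := fun i => y i + ε) (fun i => add_pos_of_nonneg_of_pos (hy i) hε)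
    simp only [List.mem_map, forall_exists_index, and_imp, forall_apply_eq_imp_iff₂]
    exact fun u hu i => add_pos_of_nonneg_of_pos (hus u hu i) hε
  have hlim : ∀ vs : List (ι → ℝ), Filter.Tendsto
      (fun ε : ℝ => wordSum Ok s (vs.map fun u i => u i + ε)) (nhdsWithin 0 (Set.Ioi 0))
      (nhds (wordSum Ok s vs)) := fun vs => by
    have := ((continuous_wordSum_add (Ok := Ok) vs s).tendsto 0).mono_left
      (nhdsWithin_le_nhds (s := Set.Ioi 0))
    simpa using this
  refine le_of_tendsto_of_tendsto ((hlim (x :: x :: us)).mul (hlim (y :: y :: us)))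
    ((hlim (x :: y :: us)).pow 2) ?_
  filter_upwards [self_mem_nhdsWithin] with ε hε using key ε hε

end WordSum

/-! ### The polymatroid of a matroid quotient, and counting its words. -/

section Quotient

variable {γ : Type*} [DecidableEq γ]

/-- The independent sets `I` of a matroid together with the rank function `rk` of a quotient. -/
structure IsMatroidQuotient (I : Finset γ → Prop) (rk : Finset γ → ℕ) : Prop where
  indep_of_insert : ∀ e S, I (insert e S) → I S
  indep_augment : ∀ S T, I S → I T → S.card < T.card → ∃ e ∈ T, e ∉ S ∧ I (insert e S)
  rk_le_insert : ∀ e S, rk S ≤ rk (insert e S)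
  rk_insert_le : ∀ e S, rk (insert e S) ≤ rk S + 1
  rk_augment : ∀ S T, rk S < rk T → ∃ e ∈ T, rk S < rk (insert e S)
  indep_insert : ∀ e S, I S → rk S < rk (insert e S) → I (insert e S)

variable [Fintype γ]

/-- The elements of `γ` that occur in a multiset on `Option γ`. -/
def someSupport (m : Multiset (Option γ)) : Finset γ := univ.filter fun e => some e ∈ m

theorem mem_someSupport {m : Multiset (Option γ)} {e : γ} : e ∈ someSupport m ↔ some e ∈ m := by
  simp [someSupport]

theorem someSupport_none_cons (m : Multiset (Option γ)) :
    someSupport (none ::ₘ m) = someSupport m := by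
  ext; simp [mem_someSupport]

theorem someSupport_some_cons (m : Multiset (Option γ)) (e : γ) :
    someSupport (some e ::ₘ m) = insert e (someSupport m) := by
  ext; simp [mem_someSupport]

/-- The polymatroid on `Option γ` in which `none` is a free element with multiplicity; its
feasible multisets of cardinality `c + r` are the independent sets `S` with `r ≤ rk S`,
completed with copies of `none`. -/
def QuotientFeasible (I : Finset γ → Prop) (rk : Finset γ → ℕ) (c : ℕ)
    (m : Multiset (Option γ)) : Prop :=
  (∀ e, m.count (some e) ≤ 1) ∧ I (someSupport m) ∧ Multiset.card m ≤ c + rk (someSupport m)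

theorem card_eq_count_none_add_card_someSupport {m : Multiset (Option γ)}
    (hm : ∀ e, m.count (some e) ≤ 1) :
    Multiset.card m = m.count none + (someSupport m).card := by
  rw [← Multiset.sum_count_eq_card (s := univ) (m := m) (by simp), Fintype.sum_option]
  congr 1
  rw [Finset.card_eq_sum_ones, someSupport, Finset.sum_filter]
  refine Finset.sum_congr rfl fun e _ => ?_
  have := hm e
  split_ifs with h
  · have := Multiset.count_pos.2 h; omega
  · exact Multiset.count_eq_zero.2 h

variable {I : Finset γ → Prop} {rk : Finset γ → ℕ}

theorem QuotientFeasible.some_cons {c : ℕ} {m : Multiset (Option γ)} {e : γ}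
    (h : QuotientFeasible I rk c m) (he : e ∉ someSupport m) (hI : I (insert e (someSupport m)))
    (hc : Multiset.card m + 1 ≤ c + rk (insert e (someSupport m))) :
    QuotientFeasible I rk c (some e ::ₘ m) := by
  refine ⟨fun f => ?_, by rwa [someSupport_some_cons], by
    rwa [someSupport_some_cons, Multiset.card_cons]⟩
  rw [Multiset.count_cons]
  split_ifs with hf
  · obtain rfl := Option.some_injective _ hf
    rw [Multiset.count_eq_zero.2 (by rwa [mem_someSupport] at he)]
  · exact h.1 f

theorem IsMatroidQuotient.isPolymatroidal (h : IsMatroidQuotient I rk) (c : ℕ) :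
    IsPolymatroidal (QuotientFeasible I rk c) where
  of_cons i m := by
    rintro ⟨h1, h2, h3⟩
    refine ⟨fun e => (Multiset.count_le_count_cons _ _ _).trans (h1 e), ?_⟩
    rw [Multiset.card_cons] at h3
    cases i with
    | none =>
      rw [someSupport_none_cons] at h2 h3
      exact ⟨h2, by omega⟩
    | some e =>
      rw [someSupport_some_cons] at h2 h3
      have := h.rk_insert_le e (someSupport m)
      exact ⟨h.indep_of_insert _ _ h2, by omega⟩
  augment s t hs ht hst := by
    have hcount : ∀ e, e ∈ someSupport t → e ∉ someSupport s →
        s.count (some e) < t.count (some e) := fun e he he' => by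
      rw [mem_someSupport] at he he'
      rw [Multiset.count_eq_zero.2 he']
      exact Multiset.count_pos.2 he
    have hs' := card_eq_count_none_add_card_someSupport hs.1
    have ht' := card_eq_count_none_add_card_someSupport ht.1
    -- If the cardinality bound is tight at `s`, the support of `t` has larger rank, and an element
    -- raising the rank relaxes the bound. Otherwise there is room for any letter: `none` if `t` has
    -- more copies, else one from matroid augmentation.
    rcases hs.2.2.eq_or_lt with heq | hlt
    · have := ht.2.2
      obtain ⟨e, het, he⟩ := h.rk_augment (someSupport s) (someSupport t) (by omega)
      have hes : e ∉ someSupport s := fun hes => by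
        rw [insert_eq_of_mem hes] at he; exact lt_irrefl _ he
      exact ⟨some e, hcount e het hes, hs.some_cons hes (h.indep_insert _ _ hs.2.1 he) (by omega)⟩
    · by_cases hn : s.count none < t.count none
      · refine ⟨none, hn, fun e => ?_, ?_, ?_⟩
        · rw [Multiset.count_cons_of_ne (by simp)]; exact hs.1 e
        · rw [someSupport_none_cons]; exact hs.2.1
        · rw [someSupport_none_cons, Multiset.card_cons]; omega
      · obtain ⟨e, het, hes, hI⟩ := h.indep_augment _ _ hs.2.1 ht.2.1 (by omega)
        have := h.rk_le_insert e (someSupport s)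
        exact ⟨some e, hcount e het hes, hs.some_cons hes hI (by omega)⟩

/-- The multiset with `a` copies of `none` and the elements of `S`. -/
def withNone (a : ℕ) (S : Finset γ) : Multiset (Option γ) :=
  Multiset.replicate a none + S.1.map some

omit [Fintype γ] in
theorem some_cons_withNone {a : ℕ} {S : Finset γ} {e : γ} (he : e ∉ S) :
    some e ::ₘ withNone a S = withNone a (insert e S) := by
  rw [withNone, withNone, Finset.insert_val_of_notMem he, Multiset.map_cons, Multiset.add_cons]

omit [Fintype γ] in
theorem count_some_withNone (a : ℕ) (S : Finset γ) (e : γ) :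
    (withNone a S).count (some e) = if e ∈ S then 1 else 0 := by
  rw [withNone, Multiset.count_add, Multiset.count_replicate,
    Multiset.count_map_eq_count' _ _ (Option.some_injective γ), Multiset.count_eq_of_nodup S.2]
  simp

theorem someSupport_withNone (a : ℕ) (S : Finset γ) : someSupport (withNone a S) = S := by
  ext e
  rw [mem_someSupport, ← Multiset.count_pos, count_some_withNone]
  split_ifs with h <;> simp [h]

omit [DecidableEq γ] [Fintype γ] in
theorem card_withNone (a : ℕ) (S : Finset γ) : Multiset.card (withNone a S) = a + S.card := by
  simp [withNone]

theorem quotientFeasible_withNone {c a : ℕ} {S : Finset γ} :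
    QuotientFeasible I rk c (withNone a S) ↔ I S ∧ a + S.card ≤ c + rk S := by
  rw [QuotientFeasible, someSupport_withNone, card_withNone]
  refine and_iff_right fun e => ?_
  rw [count_some_withNone]
  split_ifs <;> simp

/-- The coordinate vector at `none`. -/
def noneVec (γ : Type*) : Option γ → ℝ := fun i => i.elim 1 fun _ => 0

/-- The indicator vector of the complement of `none`. -/
def someVec (γ : Type*) : Option γ → ℝ := fun i => i.elim 0 fun _ => 1

omit [DecidableEq γ] in
theorem wordSum_replicate_noneVec_append (Ok : Multiset (Option γ) → Prop) (a : ℕ)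
    (s : Multiset (Option γ)) (us : List (Option γ → ℝ)) :
    wordSum Ok s (List.replicate a (noneVec γ) ++ us) =
      wordSum Ok (Multiset.replicate a none + s) us := by
  induction a generalizing s with
  | zero => simp
  | succ a ih =>
    rw [List.replicate_succ, List.cons_append, wordSum_cons, Fintype.sum_option]
    simp only [noneVec, Option.elim, one_mul, zero_mul, Finset.sum_const_zero, add_zero]
    rw [ih, Multiset.replicate_succ, Multiset.cons_add, Multiset.add_cons]

/-- Double counting of pairs `(e, T)` with `e ∈ T \ S`, where `|T \ S| = k + 1`. -/
theorem sum_card_filter_insert_subset (P : Finset γ → Prop) [DecidablePred P] (S : Finset γ)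
    (k : ℕ) :
    ∑ e ∈ Sᶜ, (univ.filter fun T => insert e S ⊆ T ∧ T.card = (insert e S).card + k ∧ P T).card =
      (k + 1) * (univ.filter fun T => S ⊆ T ∧ T.card = S.card + (k + 1) ∧ P T).card := by
  have h1 : ∀ e ∈ Sᶜ,
      (univ.filter fun T => insert e S ⊆ T ∧ T.card = (insert e S).card + k ∧ P T) =
      Finset.bipartiteAbove (fun e T => e ∈ T)
        (univ.filter fun T => S ⊆ T ∧ T.card = S.card + (k + 1) ∧ P T) e := by
    intro e he
    ext T
    rw [mem_compl] at he
    simp only [Finset.bipartiteAbove, mem_filter, mem_univ, true_and, card_insert_of_notMem he,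
      insert_subset_iff, add_assoc, add_comm 1 k]
    tauto
  rw [Finset.sum_congr rfl fun e he => congrArg card (h1 e he),
    Finset.sum_card_bipartiteAbove_eq_sum_card_bipartiteBelow,
    Finset.sum_congr rfl (g := fun _ => k + 1), Finset.sum_const, smul_eq_mul, mul_comm]
  intro T hT
  simp only [mem_filter, mem_univ, true_and] at hT
  have : Finset.bipartiteBelow (fun e T => e ∈ T) Sᶜ T = T \ S := by
    ext e
    simp [Finset.bipartiteBelow, and_comm]
  rw [this, card_sdiff_of_subset hT.1, hT.2.1]
  omega

open Classical in
theorem wordSum_withNone_replicate_someVec (c a k : ℕ) (hI : IsMatroidQuotient I rk)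
    (S : Finset γ) :
    wordSum (QuotientFeasible I rk c) (withNone a S) (List.replicate k (someVec γ)) =
      k.factorial * (univ.filter fun T => S ⊆ T ∧ T.card = S.card + k ∧
        QuotientFeasible I rk c (withNone a T)).card := by
  induction k generalizing S with
  | zero =>
    have : (univ.filter fun T => S ⊆ T ∧ T.card = S.card + 0 ∧
        QuotientFeasible I rk c (withNone a T)) =
        if QuotientFeasible I rk c (withNone a S) then {S} else ∅ := by
      ext T
      have : (S ⊆ T ∧ T.card = S.card + 0) ↔ T = S :=
        ⟨fun ⟨h1, h2⟩ => (Finset.eq_of_subset_of_card_le h1 (by omega)).symm,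
          by rintro rfl; simp⟩
      simp only [mem_filter, mem_univ, true_and]
      rw [← and_assoc, this]
      split_ifs with h
      · simp only [mem_singleton]
        exact ⟨fun h => h.1, by rintro rfl; exact ⟨rfl, h⟩⟩
      · simp only [notMem_empty, iff_false, not_and]
        rintro rfl; exact h
    rw [this, List.replicate_zero, wordSum]
    split_ifs <;> simp
  | succ k ih =>
    rw [List.replicate_succ, wordSum_cons, Fintype.sum_option]
    simp only [someVec, Option.elim, one_mul, zero_mul, zero_add]
    change ∑ e, wordSum _ (some e ::ₘ withNone a S) (List.replicate k (someVec γ)) = _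
    rw [← Finset.sum_subset (Finset.subset_univ Sᶜ)]
    · have h := sum_card_filter_insert_subset
        (fun T => QuotientFeasible I rk c (withNone a T)) S k
      rw [Finset.sum_congr rfl (g := fun e => (k.factorial : ℝ) *
        (univ.filter fun T => insert e S ⊆ T ∧ T.card = (insert e S).card + k ∧
          QuotientFeasible I rk c (withNone a T)).card), ← Finset.mul_sum, ← Nat.cast_sum, h]
      · rw [Nat.factorial_succ]; push_cast; ring
      · intro e he
        rw [mem_compl] at he
        rw [some_cons_withNone he, ih]
    · intro e _ he
      rw [mem_compl, not_not] at he
      refine wordSum_eq_zero fun t _ hOk => ?_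
      have := ((hI.isPolymatroidal c).of_add t hOk).1 e
      rw [Multiset.count_cons_self, count_some_withNone, if_pos he] at this
      omega

open Classical in
/-- `k! B_k` is log-concave, where `B_k` counts the independent `k`-sets of quotient rank at
least `r`. -/
theorem IsMatroidQuotient.factorial_mul_card_logConcave (h : IsMatroidQuotient I rk) (r k : ℕ) :
    ((k + 2).factorial * (univ.filter fun T => T.card = k + 2 ∧ I T ∧ r ≤ rk T).card) *
        (k.factorial * (univ.filter fun T => T.card = k ∧ I T ∧ r ≤ rk T).card) ≤
      ((k + 1).factorial * (univ.filter fun T => T.card = k + 1 ∧ I T ∧ r ≤ rk T).card) ^ 2 := by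
  -- With `c = k + 2` and `a + l = c + r`, the bound `a + l ≤ c + rk T` reads `r ≤ rk T`. This `c`
  -- leaves exactly `r` copies of `none` when `l = k + 2`, and these go into the fixed arguments
  -- `us`.
  have key : ∀ a l, a + l = k + 2 + r →
      wordSum (QuotientFeasible I rk (k + 2)) 0
        (List.replicate a (noneVec γ) ++ List.replicate l (someVec γ)) =
      (l.factorial * (univ.filter fun T => T.card = l ∧ I T ∧ r ≤ rk T).card : ℕ) := by
    intro a l hal
    have h0 : (Multiset.replicate a none + 0 : Multiset (Option γ)) = withNone a ∅ := by
      simp [withNone]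
    rw [wordSum_replicate_noneVec_append, h0, wordSum_withNone_replicate_someVec _ _ _ h]
    push_cast
    congr 3
    ext T
    simp only [mem_filter, mem_univ, true_and, empty_subset, card_empty, zero_add,
      quotientFeasible_withNone]
    refine and_congr_right fun hT => and_congr_right fun _ => ?_
    omega
  let us := List.replicate r (noneVec γ) ++ List.replicate k (someVec γ)
  have hperm : ∀ a b, wordSum (QuotientFeasible I rk (k + 2)) 0
      (List.replicate a (noneVec γ) ++ List.replicate b (someVec γ) ++ us) =
      wordSum (QuotientFeasible I rk (k + 2)) 0
        (List.replicate (a + r) (noneVec γ) ++ List.replicate (b + k) (someVec γ)) := by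
    intro a b
    refine wordSum_perm ?_ 0
    simp only [us, List.replicate_add, List.append_assoc]
    refine List.Perm.append_left _ ?_
    rw [← List.append_assoc, ← List.append_assoc]
    exact List.Perm.append_right _ List.perm_append_comm
  have hnone : ∀ i, 0 ≤ noneVec γ i := fun i => by cases i <;> simp [noneVec]
  have hsome : ∀ i, 0 ≤ someVec γ i := fun i => by cases i <;> simp [someVec]
  have hus : ∀ u ∈ us, ∀ i, 0 ≤ u i := by
    intro u hu
    rcases List.mem_append.1 hu with hu | hu <;> rw [List.eq_of_mem_replicate hu]
    exacts [hnone, hsome]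
  have hAF := (h.isPolymatroidal (k + 2)).wordSum_hyperbolic hus 0 (someVec γ) hnone
  have e2 := hperm 0 2
  have e0 := hperm 2 0
  have e1 := hperm 1 1
  simp only [List.replicate, List.nil_append, List.cons_append] at e0 e1 e2
  rw [key _ _ (by omega)] at e0 e1 e2
  rw [e2, e0, wordSum_swap, e1, zero_add, add_comm 2 k, add_comm 1 k] at hAF
  exact_mod_cast hAF

open Classical in
/-- The number of independent `k`-sets of quotient rank at least `r` is log-concave in `k`. -/
theorem IsMatroidQuotient.card_logConcave (h : IsMatroidQuotient I rk) (r k : ℕ) :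
    (univ.filter fun T => T.card = k + 2 ∧ I T ∧ r ≤ rk T).card *
        (univ.filter fun T => T.card = k ∧ I T ∧ r ≤ rk T).card ≤
      (univ.filter fun T => T.card = k + 1 ∧ I T ∧ r ≤ rk T).card ^ 2 := by
  have := h.factorial_mul_card_logConcave r k
  set a := (univ.filter fun T => T.card = k + 2 ∧ I T ∧ r ≤ rk T).card
  set b := (univ.filter fun T => T.card = k ∧ I T ∧ r ≤ rk T).card
  set m := (univ.filter fun T => T.card = k + 1 ∧ I T ∧ r ≤ rk T).card
  have h1 : (k + 1).factorial ^ 2 * (a * b) ≤ (k + 1).factorial ^ 2 * m ^ 2 := by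
    calc (k + 1).factorial ^ 2 * (a * b) ≤ (k + 2).factorial * a * (k.factorial * b) := by
          -- The ratio of the two sides is `(k + 2) / (k + 1)`; this gain is given up.
          have : (k + 1).factorial ^ 2 ≤ (k + 2).factorial * k.factorial := by
            rw [Nat.factorial_succ (k + 1), sq]
            nth_rewrite 2 [Nat.factorial_succ k]
            nlinarith [Nat.zero_le ((k + 1).factorial * k.factorial)]
          calc _ ≤ (k + 2).factorial * k.factorial * (a * b) := Nat.mul_le_mul_right _ this
            _ = _ := by ring
      _ ≤ _ := this
      _ = _ := by ring
  exact Nat.le_of_mul_le_mul_left h1 (by positivity)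

end Quotient

/-! ### Morphisms of matroids as quotients. -/

section Morphism

variable {α β : Type*} {M : Matroid α} {M' : Matroid β} {φ : α → β}

theorem Matroid.isMorphismBasis_iff [M'.Finite] (hφ : Set.MapsTo φ M.E M'.E) {T : Set α} :
    Matroid.IsMorphismBasis M M' φ T ↔ M.Indep T ∧ M'.eRank ≤ M'.eRk (φ '' T) := by
  rw [Matroid.IsMorphismBasis, ← Matroid.indep_iff]
  refine and_congr_right fun hT => ?_
  have hE : φ '' T ⊆ M'.E := (hφ.mono_left hT.subset_ground).image_subset
  rw [← Matroid.spanning_iff_exists_isBase_subset hE, Matroid.spanning_iff_eRk_le hE]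

open Classical in
theorem Matroid.IsMorphism.isMatroidQuotient [M.Finite] [M'.Finite]
    (hφ : Matroid.IsMorphism M M' φ) :
    IsMatroidQuotient (fun S : Finset M.E => M.Indep (Subtype.val '' (S : Set M.E)))
      (fun S => (M'.eRk (φ '' (Subtype.val '' (S : Set M.E)))).toNat) := by
  have hcoe : ∀ X : Set β, ((M'.eRk X).toNat : ℕ∞) = M'.eRk X := fun X =>
    ENat.natCast_toNat (Matroid.eRk_ne_top_iff.2 (M'.isRkFinite_set X))
  have hle : ∀ X Y : Set β, (M'.eRk X).toNat ≤ (M'.eRk Y).toNat ↔ M'.eRk X ≤ M'.eRk Y := by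
    intro X Y; rw [← Nat.cast_le (α := ℕ∞), hcoe, hcoe]
  have hlt : ∀ X Y : Set β, (M'.eRk X).toNat < (M'.eRk Y).toNat ↔ M'.eRk X < M'.eRk Y := by
    intro X Y; rw [← Nat.cast_lt (α := ℕ∞), hcoe, hcoe]
  have henc : ∀ S : Finset M.E, (Subtype.val '' (S : Set M.E)).encard = S.card := fun S => by
    rw [Subtype.val_injective.encard_image, Set.encard_coe_eq_coe_finsetCard]
  refine ⟨fun e S h => ?_, fun S T hS hT hST => ?_, fun e S => ?_, fun e S => ?_,
    fun S T h => ?_, fun e S hS h => ?_⟩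
  · exact h.subset (Set.image_mono (by simp))
  · obtain ⟨e, ⟨⟨e, heT, rfl⟩, heS⟩, hI⟩ := hS.augment hT (by
      rw [henc, henc]; exact_mod_cast hST)
    refine ⟨e, heT, fun h => heS ⟨e, h, rfl⟩, ?_⟩
    rwa [coe_insert, Set.image_insert_eq]
  · rw [hle]
    exact M'.eRk_mono (Set.image_mono (Set.image_mono (by simp)))
  · rw [← Nat.cast_le (α := ℕ∞), Nat.cast_add, hcoe, hcoe, coe_insert, Set.image_insert_eq,
      Set.image_insert_eq]
    exact M'.eRk_insert_le_add_one _ _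
  · rw [hlt] at h
    obtain ⟨y, ⟨⟨_, ⟨e, heT, rfl⟩, rfl⟩, -⟩, hy⟩ := Matroid.exists_eRk_insert_eq_add_one_of_lt h
    refine ⟨e, heT, ?_⟩
    rw [← Nat.cast_lt (α := ℕ∞), hcoe, hcoe, coe_insert, Set.image_insert_eq,
      Set.image_insert_eq, hy, ← hcoe]
    exact_mod_cast Nat.lt_succ_self _
  · by_cases heS : e ∈ S
    · rwa [insert_eq_of_mem heS]
    -- A rise in the rank of the image forces a rise in the rank of `M`, so adjoining `e` preserves
    -- independence.
    have hmor := hφ.eRk_le (T₁ := Subtype.val '' (S : Set M.E))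
      (T₂ := Subtype.val '' ((insert e S : Finset M.E) : Set M.E))
      (Set.image_mono (by simp)) (by rintro _ ⟨f, -, rfl⟩; exact f.2)
    rw [Matroid.indep_iff_eRk_eq_encard_of_finite ((Finset.finite_toSet _).image _)]
    refine le_antisymm (M.eRk_le_encard _) ?_
    rw [hS.eRk_eq_encard, henc, ← hcoe, ← hcoe (φ '' (Subtype.val '' (S : Set M.E))),
      ← ENat.natCast_toNat (Matroid.eRk_ne_top_iff.2 (M.isRkFinite_set _) :
        M.eRk (Subtype.val '' ((insert e S : Finset M.E) : Set M.E)) ≠ ⊤)] at hmor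
    rw [henc, card_insert_of_notMem heS,
      ← ENat.natCast_toNat (Matroid.eRk_ne_top_iff.2 (M.isRkFinite_set _) :
        M.eRk (Subtype.val '' ((insert e S : Finset M.E) : Set M.E)) ≠ ⊤)]
    rw [← Nat.cast_add, ← Nat.cast_add, Nat.cast_le] at hmor
    rw [Nat.cast_le]
    omega

open Classical in
theorem Matroid.numMorphismBases_eq_card [M.Finite] [M'.Finite] [Fintype M.E]
    (hφ : Set.MapsTo φ M.E M'.E) (k : ℕ) :
    Matroid.numMorphismBases M M' φ k = (univ.filter fun S : Finset M.E => S.card = k ∧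
      M.Indep (Subtype.val '' (S : Set M.E)) ∧
      M'.eRank.toNat ≤ (M'.eRk (φ '' (Subtype.val '' (S : Set M.E)))).toNat).card := by
  have hinj : Function.Injective fun S : Finset M.E => (Subtype.val '' (S : Set M.E) : Set α) :=
    (Subtype.val_injective.image_injective).comp Finset.coe_injective
  have hrank : ∀ X, (M'.eRank.toNat ≤ (M'.eRk X).toNat ↔ M'.eRank ≤ M'.eRk X) := fun X => by
    rw [← Nat.cast_le (α := ℕ∞), ENat.natCast_toNat (Matroid.eRk_ne_top_iff.2 (M'.isRkFinite_set X)),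
      ENat.natCast_toNat]
    rw [← M'.eRk_ground]
    exact Matroid.eRk_ne_top_iff.2 (M'.isRkFinite_set _)
  rw [Matroid.numMorphismBases, ← Set.ncard_coe_finset, ← Set.ncard_image_of_injective _ hinj]
  congr 1
  ext T
  simp only [Set.mem_ofPred_eq, Matroid.isMorphismBasis_iff hφ, coe_filter, mem_univ, true_and,
    Set.mem_image, hrank]
  have hcard : ∀ S : Finset M.E, (Subtype.val '' (S : Set M.E)).ncard = S.card := fun S => by
    rw [Set.ncard_image_of_injective _ Subtype.val_injective, Set.ncard_coe_finset]
  constructor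
  · rintro ⟨⟨hT, hr⟩, hk⟩
    obtain ⟨S, rfl⟩ : ∃ S : Finset M.E, Subtype.val '' (S : Set M.E) = T :=
      ⟨univ.filter fun e => e.1 ∈ T, by
        ext x
        simpa using fun hx => hT.subset_ground hx⟩
    exact ⟨S, ⟨by rw [← hcard, hk], hT, hr⟩, rfl⟩
  · rintro ⟨S, ⟨hk, hT, hr⟩, rfl⟩
    exact ⟨⟨hT, hr⟩, by rw [hcard, hk]⟩

end Morphism

theorem mainTheorem2 {α β : Type*} (M : Matroid α) (M' : Matroid β) [M.Finite] [M'.Finite]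
    (φ : α → β) (hφ : Matroid.IsMorphism M M' φ) (k : ℕ) (hk : 1 ≤ k) :
    Matroid.numMorphismBases M M' φ (k + 1) * Matroid.numMorphismBases M M' φ (k - 1)
      ≤ Matroid.numMorphismBases M M' φ k ^ 2 := by
  classical
  obtain ⟨k, rfl⟩ := Nat.exists_eq_add_of_le' hk
  have : Fintype M.E := M.ground_finite.fintype
  simp only [Matroid.numMorphismBases_eq_card hφ.mapsTo, Nat.add_sub_cancel]
  convert hφ.isMatroidQuotient.card_logConcave M'.eRank.toNat k using 3
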